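/- Let $\Bbbk$ be an algebraically closed field of characteristic zero and let $h\in\Bbbk[x]$ be a monic polynomial of degree $N\ge 1$ whose coefficient of $x^{N-1}$ is zero. Let $A_h$ be the $\Bbbk$-algebra generated by $x$ and $t$ subject to the relation $tx=xt+h(x)$. For $r\in\Bbbk[x]$ let $\sigma_{r}$ be the automorphism of $A_h$ with $\sigma_{r}(x)=x$, $\sigma_{r}(t)=t+r(x)$; for $a\in\Bbbk^*$ with $h(ax)=a^Nh(x)$ let $\tau_a$ be the automorphism of $A_h$ with $\tau_a(x)=ax$, $\tau_a(t)=a^{N-1}t$. For $w\in A_h$ let $ad_w$ be the inner derivation $u\mapsto wu-uw$, and for $s\in\Bbbk[x]$ with $\deg s<N$ (where $\deg 0=-\infty$) let $\Delta_{s}$ be the derivation of $A_h$ with $\Delta_{s}(x)=0$, $\Delta_{s}(t)=s(x)$. For a $\Bbbk$-derivation $D$ of $A_h$ put $\mathrm{Aut}_D(A_h)=\{\rho\in\mathrm{Aut}_{\Bbbk}(A_h) : \rho D=D\rho\}$. (1) For all $w\in A_h$ and $s\in\Bbbk[x]$ with $\deg s<N$, the derivation $D=ad_w+\Delta_{s}$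 satisfies $$\mathrm{Aut}_D(A_h)=\bigl\{\rho=\sigma_{r}\circ\tau_a \;:\; r\in\Bbbk[x],\ a\in\Bbbk^*,\ h(ax)=a^Nh(x),\ \rho(w)-w\in\Bbbk,\ s(ax)=a^{N-1}s(x)\bigr\}.$$ (2) If $\gcd(h,h')=1$, then every $\Bbbk$-derivation $D$ of $A_h$ can be written as $D=ad_w+\Delta_{s}$ with $w\in A_h$, $s\in\Bbbk[x]$, $\deg s<N$, and hence $\mathrm{Aut}_D(A_h)$ is given by the formula in (1). -/

import Mathlib

open Polynomial

/-! ### Derivations of a (not necessarily commutative) algebra, and isotropy groups -/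

/-- `Der(R)`: the space of `k`-derivations of a (possibly noncommutative) `k`-algebra `R`. -/
def Der (k R : Type*) [CommRing k] [Ring R] [Algebra k R] : Submodule k (R →ₗ[k] R) where
  carrier := {D | ∀ u v : R, D (u * v) = D u * v + u * D v}
  add_mem' := by
    intro D E hD hE u v
    simp only [Set.mem_ofPred_eq, LinearMap.add_apply] at *
    rw [hD, hE, add_mul, mul_add]
    abel
  zero_mem' := by
    intro u v
    simp
  smul_mem' := by
    intro c D hD u v
    simp only [Set.mem_ofPred_eq, LinearMap.smul_apply] at *
    rw [hD, smul_add, smul_mul_assoc, mul_smul_comm]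

/-- The inner derivation `ad_w : u ↦ w u - u w`. -/
def adDer (k : Type*) {R : Type*} [CommRing k] [Ring R] [Algebra k R] (w : R) : Der k R :=
  ⟨LinearMap.mulLeft k w - LinearMap.mulRight k w, by
    intro u v
    simp only [LinearMap.sub_apply, LinearMap.mulLeft_apply, LinearMap.mulRight_apply]
    noncomm_ring⟩

/-- The isotropy group `Aut_D(R) = {ρ ∈ Aut(R) | ρ D = D ρ}` of a derivation `D`. -/
def isotropyGroup {k R : Type*} [CommRing k] [Ring R] [Algebra k R] (D : Der k R) :
    Subgroup (R ≃ₐ[k] R) where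
  carrier := {ρ | ∀ u : R, ρ (D.1 u) = D.1 (ρ u)}
  mul_mem' := by
    intro ρ φ hρ hφ u
    rw [AlgEquiv.mul_apply, AlgEquiv.mul_apply, hφ, hρ]
  one_mem' := by
    intro u
    rfl
  inv_mem' := by
    intro ρ hρ u
    apply ρ.injective
    rw [hρ, ← AlgEquiv.mul_apply, ← AlgEquiv.mul_apply, mul_inv_cancel]
    rfl

/-! ### The differential Ore extension `A_h` -/

/-- The two generators of `A_h`. -/
inductive OreGen : Type
  | x : OreGen
  | t : OreGen

/-- The defining relation `t x = x t + h(x)`. -/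
inductive OreRel {k : Type*} [Field k] (h : k[X]) :
    FreeAlgebra k OreGen → FreeAlgebra k OreGen → Prop
  | comm : OreRel h
      (FreeAlgebra.ι k OreGen.t * FreeAlgebra.ι k OreGen.x)
      (FreeAlgebra.ι k OreGen.x * FreeAlgebra.ι k OreGen.t +
        aeval (FreeAlgebra.ι k OreGen.x) h)

/-- `A_h = k[x][t; h ∂ₓ]`: the `k`-algebra generated by `x` and `t` subject to the single relation
`t x = x t + h(x)`. -/
def OreAlg {k : Type*} [Field k] (h : k[X]) : Type _ := RingQuot (OreRel h)

namespace OreAlg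

variable {k : Type*} [Field k] (h : k[X])

noncomputable instance : Ring (OreAlg h) := inferInstanceAs (Ring (RingQuot (OreRel h)))

noncomputable instance : Algebra k (OreAlg h) :=
  inferInstanceAs (Algebra k (RingQuot (OreRel h)))

/-- The quotient map from the free algebra. -/
noncomputable def mk : FreeAlgebra k OreGen →ₐ[k] OreAlg h := RingQuot.mkAlgHom k (OreRel h)

/-- The generator `x`. -/
noncomputable def x : OreAlg h := mk h (FreeAlgebra.ι k OreGen.x)

/-- The generator `t`. -/
noncomputable def t : OreAlg h := mk h (FreeAlgebra.ι k OreGen.t)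

theorem t_mul_x : t h * x h = x h * t h + aeval (x h) h := by
  have H : mk h _ = mk h _ := RingQuot.mkAlgHom_rel k (OreRel.comm (h := h))
  rw [map_mul, map_add, map_mul, ← aeval_algHom_apply] at H
  exact H

variable {h}

/-- The universal property of `A_h`: a pair `(u, v)` with `v u = u v + h(u)` defines a homomorphism
`x ↦ u`, `t ↦ v`. -/
noncomputable def lift {B : Type*} [Ring B] [Algebra k B] (u v : B)
    (huv : v * u = u * v + aeval u h) : OreAlg h →ₐ[k] B :=
  RingQuot.liftAlgHom k
    ⟨FreeAlgebra.lift k (fun g : OreGen => OreGen.casesOn g u v), by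
      rintro _ _ ⟨⟩
      rw [map_mul, map_add, map_mul, ← aeval_algHom_apply]
      simpa using huv⟩

@[simp] theorem lift_x {B : Type*} [Ring B] [Algebra k B] (u v : B)
    (huv : v * u = u * v + aeval u h) : lift u v huv (x h) = u := by
  unfold lift x mk
  erw [RingQuot.liftAlgHom_mkAlgHom_apply]
  simp

@[simp] theorem lift_t {B : Type*} [Ring B] [Algebra k B] (u v : B)
    (huv : v * u = u * v + aeval u h) : lift u v huv (t h) = v := by
  unfold lift t mk
  erw [RingQuot.liftAlgHom_mkAlgHom_apply]
  simp

theorem hom_ext {B : Type*} [Ring B] [Algebra k B] {f g : OreAlg h →ₐ[k] B}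
    (hx : f (x h) = g (x h)) (ht : f (t h) = g (t h)) : f = g := by
  have H : f.comp (mk h) = g.comp (mk h) := by
    apply FreeAlgebra.hom_ext
    funext i
    cases i
    · exact hx
    · exact ht
  apply AlgHom.ext
  intro u
  obtain ⟨v, rfl⟩ := RingQuot.mkAlgHom_surjective k (OreRel h) u
  exact DFunLike.congr_fun H v

theorem commute_aeval_x (p q : k[X]) :
    aeval (x h) p * aeval (x h) q = aeval (x h) q * aeval (x h) p := by
  rw [← map_mul, mul_comm, map_mul]

/-- The endomorphism `x ↦ x`, `t ↦ t + r(x)`. -/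
noncomputable def sigmaHom (r : k[X]) : OreAlg h →ₐ[k] OreAlg h :=
  lift (x h) (t h + aeval (x h) r) (by
    have := commute_aeval_x (h := h) r X
    rw [aeval_X] at this
    rw [add_mul, mul_add, t_mul_x, this]
    abel)

theorem sigmaHom_comp (r q : k[X]) (hrq : r + q = 0) :
    (sigmaHom r).comp (sigmaHom q) = AlgHom.id k (OreAlg h) := by
  apply hom_ext
  · simp [sigmaHom]
  · simp only [sigmaHom, AlgHom.comp_apply, lift_t, map_add, ← aeval_algHom_apply, lift_x]
    rw [add_assoc, ← map_add, hrq, map_zero, add_zero]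
    rfl

/-- The automorphism `σ_r` of `A_h`: `σ_r(x) = x`, `σ_r(t) = t + r(x)`. -/
noncomputable def sigma (r : k[X]) : OreAlg h ≃ₐ[k] OreAlg h :=
  AlgEquiv.ofAlgHom (sigmaHom r) (sigmaHom (-r))
    (sigmaHom_comp _ _ (by simp)) (sigmaHom_comp _ _ (by simp))

@[simp] theorem sigma_x (r : k[X]) : sigma r (x h) = x h := lift_x _ _ _

@[simp] theorem sigma_t (r : k[X]) : sigma r (t h) = t h + aeval (x h) r := lift_t _ _ _

/-- The endomorphism `x ↦ a x`, `t ↦ a ^ (N - 1) t`, where `N = deg h` and `h(a x) = a ^ N h(x)`. -/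
noncomputable def tauHom (a : kˣ)
    (ha : h.comp (C (a : k) * X) = C ((a : k) ^ h.natDegree) * h) : OreAlg h →ₐ[k] OreAlg h :=
  lift ((a : k) • x h) (((a ^ ((h.natDegree : ℤ) - 1) : kˣ) : k) • t h) (by
    have h1 : aeval ((a : k) • x h) h = (a : k) ^ h.natDegree • aeval (x h) h := by
      have := congrArg (aeval (x h)) ha
      rw [aeval_comp, map_mul, map_mul, aeval_C, aeval_C, aeval_X, ← Algebra.smul_def,
        ← Algebra.smul_def] at this
      exact this
    have h2 : ((a ^ ((h.natDegree : ℤ) - 1) : kˣ) : k) * (a : k) = (a : k) ^ h.natDegree := by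
      rw [← Units.val_mul, ← zpow_add_one, sub_add_cancel, zpow_natCast, Units.val_pow_eq_pow_val]
    rw [h1, smul_mul_smul_comm, smul_mul_smul_comm, mul_comm (a : k), h2, t_mul_x, smul_add])

theorem scale_inv (a : kˣ) (ha : h.comp (C (a : k) * X) = C ((a : k) ^ h.natDegree) * h) :
    h.comp (C ((a⁻¹ : kˣ) : k) * X) = C (((a⁻¹ : kˣ) : k) ^ h.natDegree) * h := by
  have h1 := congrArg (fun p => p.comp (C ((a⁻¹ : kˣ) : k) * X)) ha
  simp only [comp_assoc, mul_comp, C_comp, X_comp] at h1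
  rw [← mul_assoc, ← C_mul, Units.mul_inv, C_1, one_mul, comp_X] at h1
  have h2 := congrArg (fun p => C (((a⁻¹ : kˣ) : k) ^ h.natDegree) * p) h1
  simp only [← mul_assoc, ← C_mul, ← mul_pow, Units.inv_mul, one_pow, C_1, one_mul] at h2
  exact h2.symm

theorem tauHom_comp (a b : kˣ) (ha : h.comp (C (a : k) * X) = C ((a : k) ^ h.natDegree) * h)
    (hb : h.comp (C (b : k) * X) = C ((b : k) ^ h.natDegree) * h) (hab : a * b = 1) :
    (tauHom a ha).comp (tauHom b hb) = AlgHom.id k (OreAlg h) := by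
  apply hom_ext
  · simp only [tauHom, AlgHom.comp_apply, lift_x, map_smul, smul_smul, ← Units.val_mul]
    rw [mul_comm, hab, Units.val_one, one_smul]
    rfl
  · simp only [tauHom, AlgHom.comp_apply, lift_t, map_smul, smul_smul, ← Units.val_mul]
    rw [← mul_zpow, mul_comm, hab, one_zpow, Units.val_one, one_smul]
    rfl

/-- The automorphism `τ_a` of `A_h`, for `a ∈ k*` with `h(a x) = a ^ N h(x)`, `N = deg h`:
`τ_a(x) = a x`, `τ_a(t) = a ^ (N - 1) t`. -/
noncomputable def tau (a : kˣ)
    (ha : h.comp (C (a : k) * X) = C ((a : k) ^ h.natDegree) * h) : OreAlg h ≃ₐ[k] OreAlg h :=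
  AlgEquiv.ofAlgHom (tauHom a ha) (tauHom a⁻¹ (scale_inv a ha))
    (tauHom_comp _ _ _ _ (mul_inv_cancel a)) (tauHom_comp _ _ _ _ (inv_mul_cancel a))

@[simp] theorem tau_x (a : kˣ) (ha : h.comp (C (a : k) * X) = C ((a : k) ^ h.natDegree) * h) :
    tau a ha (x h) = (a : k) • x h := lift_x _ _ _

@[simp] theorem tau_t (a : kˣ) (ha : h.comp (C (a : k) * X) = C ((a : k) ^ h.natDegree) * h) :
    tau a ha (t h) = ((a ^ ((h.natDegree : ℤ) - 1) : kˣ) : k) • t h := lift_t _ _ _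

/-- The homomorphism `A_h → A_h[ε]`, `ε² = 0`, with `x ↦ x`, `t ↦ t + s(x) ε`; its `ε`-part
is the derivation `Δ_s`. -/
noncomputable def deltaHom (s : k[X]) : OreAlg h →ₐ[k] TrivSqZeroExt (OreAlg h) (OreAlg h) :=
  lift (TrivSqZeroExt.inl (x h))
    (TrivSqZeroExt.inl (t h) + TrivSqZeroExt.inr (aeval (x h) s)) (by
    have h1 : aeval (TrivSqZeroExt.inl (x h) : TrivSqZeroExt (OreAlg h) (OreAlg h)) h =
        TrivSqZeroExt.inl (aeval (x h) h) :=
      aeval_algHom_apply (TrivSqZeroExt.inlAlgHom k (OreAlg h) (OreAlg h)) (x h) h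
    have h2 := commute_aeval_x (h := h) s X
    rw [aeval_X] at h2
    rw [h1]
    ext
    · simp [t_mul_x]
    · simp [h2])

theorem deltaHom_fst (s : k[X]) (u : OreAlg h) : (deltaHom s u).fst = u := by
  have : (TrivSqZeroExt.fstHom k (OreAlg h) (OreAlg h)).comp (deltaHom s) =
      AlgHom.id k (OreAlg h) := by
    apply hom_ext
    · simp [deltaHom]
    · simp [deltaHom]
  exact DFunLike.congr_fun this u

/-- The derivation `Δ_s` of `A_h`: `Δ_s(x) = 0`, `Δ_s(t) = s(x)` (a derivation is determined by
its values on the generators `x`, `t`). -/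
noncomputable def Delta (s : k[X]) : Der k (OreAlg h) :=
  ⟨{ toFun := fun u => (deltaHom s u).snd
     map_add' := by
      intro u v
      rw [map_add, TrivSqZeroExt.snd_add]
     map_smul' := by
      intro c u
      rw [map_smul, TrivSqZeroExt.snd_smul]
      rfl }, by
    intro u v
    change (deltaHom s (u * v)).snd = (deltaHom s u).snd * v + u * (deltaHom s v).snd
    rw [map_mul, TrivSqZeroExt.snd_mul, deltaHom_fst, deltaHom_fst, smul_eq_mul,
      MulOpposite.smul_eq_mul_unop, MulOpposite.unop_op, add_comm]⟩

@[simp] theorem Delta_x (s : k[X]) : (Delta s).1 (x h) = 0 := by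
  change (deltaHom s (x h)).snd = 0
  simp [deltaHom]

@[simp] theorem Delta_t (s : k[X]) : (Delta s).1 (t h) = aeval (x h) s := by
  change (deltaHom s (t h)).snd = _
  simp [deltaHom]

end OreAlg

/-!
# Isotropy groups of derivations of `A_h = k[x][t; h ∂ₓ]`

The algebra `A_h` acts on `k[x][Y]`, `x` by multiplication and `t` as `Y + h ∂ₓ`. Acting on `1`
identifies `A_h` with `k[x][Y]` as a left `k[x]`-module, which gives unique normal forms
`∑ fᵢ(x) tⁱ` and a degree in `t` that is additive on products (`natDegree_nf_mul`). Two facts about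
commutators carry the argument. All commutators lie in the two-sided ideal `h(x) A_h`
(`dvd_commutator`). The commutator with `x` is `h ∂/∂t` on leading terms, so in characteristic zero
its kernel is `k[x]` and its image is all of `h(x) A_h` (`exists_eq_aeval_of_commute_x`,
`exists_commutator_x_eq`).

Since `h(x) = [t, x]`, an automorphism `ρ` maps `h(x)` to an element dividing `h(x)` and divisible
by it. The first forces `ρ(x) = g(x)` for degree reasons; then `h ∘ g` and `h` are associated, and
the vanishing coefficient of `x ^ (N - 1)` leaves only `g = a x`. The commutator of `ρ(t)` with `x`
determines `ρ(t)` up to `k[x]`, and `ρ = σ_r τ_a` (`exists_eq_sigma_mul_tau`). Such a `ρ` commutes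
with `ad_w + Δ_s` if and only if it does so on `x` and `t`, and these two conditions separate into
those on `w` and on `s` because `deg s < deg h` (`sigma_mul_tau_mem_isotropyGroup_iff`).

If `h` and `h'` are coprime, a derivation `D` maps `x` into `h(x) A_h`, because
`h'(x) D(x) ≡ D(h(x)) = D([t, x]) ≡ 0` modulo `h(x) A_h`. Hence `D(x) = [w, x]` for some `w`, and
`D - ad_w` kills `x`, so it maps `t` into the centralizer `k[x]` of `x`. Division by `h` splits its
value at `t` into a multiple of `h`, which comes from an inner derivation, and a remainder `s`.
-/

/-! ### General facts on derivations and on the generators of `A_h` -/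

theorem Der.map_algebraMap {k R : Type*} [CommRing k] [Ring R] [Algebra k R] (D : Der k R) (c : k) :
    D.1 (algebraMap k R c) = 0 := by
  have e := D.2 1 1
  rw [mul_one, one_mul, mul_one, left_eq_add] at e
  rw [Algebra.algebraMap_eq_smul_one, map_smul, e, smul_zero]

theorem Der.add_apply {k R : Type*} [CommRing k] [Ring R] [Algebra k R] (D E : Der k R) (u : R) :
    (D + E).1 u = D.1 u + E.1 u := rfl

theorem adDer_apply {k R : Type*} [CommRing k] [Ring R] [Algebra k R] (w u : R) :
    (adDer k w).1 u = w * u - u * w := rfl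

namespace OreAlg

variable {k : Type*} [Field k] {h : k[X]}

theorem generator_induction {P : OreAlg h → Prop} (hc : ∀ c : k, P (algebraMap k (OreAlg h) c))
    (hx : P (x h)) (ht : P (t h)) (hadd : ∀ u v, P u → P v → P (u + v))
    (hmul : ∀ u v, P u → P v → P (u * v)) (u : OreAlg h) : P u := by
  obtain ⟨v, rfl⟩ := RingQuot.mkAlgHom_surjective k (OreRel h) u
  change P (mk h v)
  induction v using FreeAlgebra.induction with
  | grade0 c => rw [AlgHom.commutes]; exact hc c
  | grade1 g => cases g <;> assumption
  | mul a b ha hb => rw [map_mul]; exact hmul _ _ ha hb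
  | add a b ha hb => rw [map_add]; exact hadd _ _ ha hb

theorem t_mul_aeval (p : k[X]) :
    t h * aeval (x h) p = aeval (x h) p * t h + aeval (x h) (h * derivative p) := by
  have hcx : ∀ q : k[X], x h * aeval (x h) q = aeval (x h) q * x h := fun q => by
    simpa using commute_aeval_x (h := h) X q
  induction p using Polynomial.induction_on' with
  | add p q hp hq => simp only [map_add, mul_add, add_mul, hp, hq]; abel
  | monomial n c =>
    induction n with
    | zero => simp [Algebra.commutes]
    | succ n ih =>
      have e : (monomial (n + 1) c : k[X]) = monomial n c * X := (monomial_mul_X n c).symm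
      rw [e, map_mul, aeval_X, ← mul_assoc, ih, add_mul, mul_assoc, t_mul_x, derivative_mul,
        derivative_X, mul_one, mul_add, mul_add, map_add]
      have e1 : aeval (x h) (h * (derivative (monomial n c) * X)) =
          aeval (x h) (h * derivative (monomial n c)) * x h := by
        rw [← mul_assoc, map_mul, aeval_X]
      have e2 : aeval (x h) (h * monomial n c) = aeval (x h) (monomial n c) * aeval (x h) h := by
        rw [mul_comm, map_mul]
      rw [e1, e2, mul_assoc (aeval (x h) (monomial n c)) (x h)]
      abel

/-! ### Normal forms and the degree in `t` -/

/-- The map `k[x][Y] → A_h` sending `∑ fᵢ(x) Yⁱ` to the ordered expression `∑ fᵢ(x) tⁱ`. -/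
noncomputable def ofNF : k[X][X] →ₗ[k] OreAlg h :=
  lsum fun i => (LinearMap.mulRight k (t h ^ i)).comp (aeval (x h)).toLinearMap

theorem ofNF_monomial (i : ℕ) (f : k[X]) :
    ofNF (monomial i f) = aeval (x h) f * t h ^ i := by
  simp [ofNF, lsum_apply, sum_monomial_index]

/-- The derivation `h ∂ₓ` applied to the coefficients of a polynomial in `Y` over `k[x]`. -/
noncomputable def coeffDer (h : k[X]) : k[X][X] →ₗ[k] k[X][X] :=
  lsum fun i => ((monomial i).restrictScalars k).comp ((LinearMap.mulLeft k h).comp derivative)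

theorem coeffDer_monomial (i : ℕ) (f : k[X]) :
    coeffDer h (monomial i f) = monomial i (h * derivative f) := by
  simp [coeffDer, lsum_apply, sum_monomial_index]

theorem coeff_coeffDer (p : k[X][X]) (n : ℕ) :
    (coeffDer h p).coeff n = h * derivative (p.coeff n) := by
  induction p using Polynomial.induction_on' with
  | add p q hp hq => simp only [map_add, coeff_add, hp, hq, mul_add]
  | monomial i f =>
    rw [coeffDer_monomial, coeff_monomial, coeff_monomial]
    split_ifs <;> simp

theorem aeval_lmul_C_X (p : k[X]) :
    aeval (Algebra.lmul k k[X][X] (C X)) p = Algebra.lmul k k[X][X] (C p) := by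
  have e := aeval_algHom_apply ((CAlgHom : k[X] →ₐ[k[X]] k[X][X]).restrictScalars k) X p
  have e' : aeval (C X : k[X][X]) p = C p := by simpa using e
  rw [aeval_algHom_apply, e']

/-- The representation of `A_h` on `k[x][Y]` in which `x` acts by multiplication and `t` acts as
`Y + h ∂ₓ`. -/
noncomputable def rep : OreAlg h →ₐ[k] Module.End k k[X][X] :=
  lift (Algebra.lmul k k[X][X] (C X)) (Algebra.lmul k k[X][X] X + coeffDer h) (by
    rw [aeval_lmul_C_X]
    refine LinearMap.ext fun p => ?_
    ext1 n
    simp only [Module.End.mul_apply, LinearMap.add_apply, Algebra.coe_lmul_eq_mul,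
      LinearMap.mul_apply', coeff_add, mul_add, coeff_coeffDer, coeff_C_mul, derivative_mul,
      derivative_X]
    rw [mul_left_comm, coeff_C_mul]
    ring)

theorem rep_x (q : k[X][X]) : rep (x h) q = C X * q := by
  simp [rep]

theorem rep_t (q : k[X][X]) : rep (t h) q = X * q + coeffDer h q := by
  simp [rep]

theorem rep_aeval (p : k[X]) (q : k[X][X]) : rep (aeval (x h) p) q = C p * q := by
  have e : rep (aeval (x h) p) = Algebra.lmul k k[X][X] (C p) := by
    rw [← aeval_algHom_apply, rep, lift_x, aeval_lmul_C_X]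
  simp [e]

/-- The normal form of an element of `A_h`: its action on `1`. Since `h ∂ₓ` kills the powers of `Y`,
`∑ fᵢ(x) tⁱ` has normal form `∑ fᵢ(x) Yⁱ`, so `(nf u).natDegree` is the degree of `u` in `t`. -/
noncomputable def nf : OreAlg h →ₗ[k] k[X][X] :=
  (LinearMap.applyₗ (1 : k[X][X])).comp (rep (h := h)).toLinearMap

theorem nf_apply (u : OreAlg h) : nf u = rep u 1 := rfl

theorem nf_mul (u v : OreAlg h) : nf (u * v) = rep u (nf v) := by
  simp [nf_apply]

theorem nf_aeval_mul (p : k[X]) (u : OreAlg h) : nf (aeval (x h) p * u) = C p * nf u := by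
  rw [nf_mul, rep_aeval]

theorem nf_aeval (p : k[X]) : nf (aeval (x h) p) = C p := by
  rw [nf_apply, rep_aeval, mul_one]

theorem nf_t_pow (i : ℕ) : nf (t h ^ i) = X ^ i := by
  induction i with
  | zero => simp [nf_apply]
  | succ i ih =>
    rw [pow_succ', nf_mul, ih, rep_t, ← monomial_one_right_eq_X_pow, coeffDer_monomial]
    rw [X_mul_monomial, derivative_one, mul_zero, map_zero, add_zero,
      monomial_one_right_eq_X_pow]

/-- `ofNF` is `A_h`-linear; evaluated at `1`, this makes it a left inverse of `nf`. -/
theorem ofNF_rep (u : OreAlg h) (q : k[X][X]) : ofNF (rep u q) = u * ofNF q := by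
  induction u using generator_induction generalizing q with
  | hc c => rw [AlgHom.commutes, Module.algebraMap_end_apply, map_smul, Algebra.smul_def]
  | hx =>
    induction q using Polynomial.induction_on' with
    | add p q hp hq => simp only [map_add, mul_add, hp, hq]
    | monomial i f =>
      rw [rep_x, C_mul_monomial, ofNF_monomial, ofNF_monomial, map_mul, aeval_X, mul_assoc]
  | ht =>
    induction q using Polynomial.induction_on' with
    | add p q hp hq => simp only [map_add, mul_add, hp, hq]
    | monomial i f =>
      rw [rep_t, X_mul_monomial, coeffDer_monomial, map_add, ofNF_monomial, ofNF_monomial,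
        ofNF_monomial, ← mul_assoc, t_mul_aeval, add_mul, pow_succ', mul_assoc]
  | hadd u v hu hv => simp only [map_add, LinearMap.add_apply, add_mul, hu, hv]
  | hmul u v hu hv => rw [map_mul, Module.End.mul_apply, hu, hv, mul_assoc]

theorem ofNF_nf (u : OreAlg h) : ofNF (nf u) = u := by
  rw [nf_apply, ofNF_rep, ← monomial_zero_one, ofNF_monomial]
  simp

theorem nf_ofNF (p : k[X][X]) : nf (ofNF p : OreAlg h) = p := by
  induction p using Polynomial.induction_on' with
  | add p q hp hq => simp only [map_add, hp, hq]
  | monomial i f => rw [ofNF_monomial, nf_aeval_mul, nf_t_pow, C_mul_X_pow_eq_monomial]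

theorem nf_injective : Function.Injective (nf : OreAlg h → k[X][X]) :=
  Function.LeftInverse.injective ofNF_nf

theorem nf_eq_zero {u : OreAlg h} : nf u = 0 ↔ u = 0 :=
  map_eq_zero_iff nf nf_injective

theorem aeval_x_injective : Function.Injective (aeval (x h) : k[X] → OreAlg h) := by
  intro p q hpq
  have := congrArg nf hpq
  rwa [nf_aeval, nf_aeval, C_inj] at this

theorem eq_aeval_of_natDegree_nf {u : OreAlg h} (hu : (nf u).natDegree = 0) :
    u = aeval (x h) ((nf u).coeff 0) := by
  apply nf_injective
  rw [nf_aeval]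
  exact eq_C_of_natDegree_eq_zero hu

theorem dvd_of_aeval_dvd_aeval {p q : k[X]} (hpq : aeval (x h) p ∣ aeval (x h) q) : p ∣ q := by
  obtain ⟨u, hu⟩ := hpq
  have := congrArg (fun v => (nf v).coeff 0) hu
  simp only [nf_aeval, nf_aeval_mul, coeff_C_mul, coeff_C_zero] at this
  exact ⟨_, this⟩

/-- On leading terms in `Y`, the operator `tⁱ` acts as multiplication by `Yⁱ`. The bound `n` need
not be attained, which keeps the statement additive. -/
theorem rep_t_pow_bound (i : ℕ) {n : ℕ} {q : k[X][X]} (hq : q.natDegree ≤ n) :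
    (rep (t h ^ i) q).natDegree ≤ i + n ∧ (rep (t h ^ i) q).coeff (i + n) = q.coeff n := by
  induction i with
  | zero => simpa using hq
  | succ i ih =>
    have hz : ∀ j, i + n < j → (rep (t h ^ i) q).coeff j = 0 := fun j hj =>
      coeff_eq_zero_of_natDegree_lt (ih.1.trans_lt hj)
    rw [pow_succ', map_mul, Module.End.mul_apply, rep_t, add_right_comm]
    constructor
    · rw [natDegree_le_iff_coeff_eq_zero]
      intro j hj
      obtain ⟨j, rfl⟩ : ∃ j', j = j' + 1 := ⟨j - 1, by omega⟩
      rw [coeff_add, coeff_X_mul, coeff_coeffDer, hz _ (by omega), hz _ (by omega)]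
      simp
    · rw [coeff_add, coeff_X_mul, coeff_coeffDer, ih.2, hz _ (by omega)]
      simp

theorem eq_sum_range {u : OreAlg h} {m : ℕ} (hu : (nf u).natDegree ≤ m) :
    u = ∑ i ∈ Finset.range (m + 1), aeval (x h) ((nf u).coeff i) * t h ^ i := by
  conv_lhs => rw [← ofNF_nf u, (nf u).as_sum_range' (m + 1) (by omega), map_sum]
  simp only [ofNF_monomial]

/-- Leading coefficients in `t` multiply. -/
theorem nf_mul_bound {u v : OreAlg h} {m n : ℕ} (hu : (nf u).natDegree ≤ m)
    (hv : (nf v).natDegree ≤ n) :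
    (nf (u * v)).natDegree ≤ m + n ∧
      (nf (u * v)).coeff (m + n) = (nf u).coeff m * (nf v).coeff n := by
  have e : nf (u * v) =
      ∑ i ∈ Finset.range (m + 1), C ((nf u).coeff i) * rep (t h ^ i) (nf v) := by
    conv_lhs => rw [eq_sum_range hu, Finset.sum_mul, map_sum]
    simp only [mul_assoc, nf_mul, rep_aeval]
  have hb := fun i => rep_t_pow_bound (h := h) i hv
  rw [e]
  constructor
  · refine natDegree_sum_le_of_forall_le _ _ fun i hi => ?_
    rw [Finset.mem_range] at hi
    exact (natDegree_C_mul_le _ _).trans ((hb i).1.trans (by omega))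
  · rw [finsetSum_coeff, Finset.sum_range_succ, Finset.sum_eq_zero, zero_add, coeff_C_mul, (hb m).2]
    intro i hi
    rw [Finset.mem_range] at hi
    rw [coeff_C_mul, coeff_eq_zero_of_natDegree_lt ((hb i).1.trans_lt (by omega)), mul_zero]

theorem natDegree_nf_mul {u v : OreAlg h} (hu : u ≠ 0) (hv : v ≠ 0) :
    (nf (u * v)).natDegree = (nf u).natDegree + (nf v).natDegree := by
  obtain ⟨h1, h2⟩ := nf_mul_bound (le_refl (nf u).natDegree) (le_refl (nf v).natDegree)
  refine le_antisymm h1 (le_natDegree_of_ne_zero ?_)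
  rw [h2]
  exact mul_ne_zero (leadingCoeff_ne_zero.mpr (nf_eq_zero.not.mpr hu))
    (leadingCoeff_ne_zero.mpr (nf_eq_zero.not.mpr hv))

/-- An element of positive degree in `t` is transcendental over `k`, and its non-constant
polynomial expressions again have positive degree. -/
theorem natDegree_nf_aeval_pos {u : OreAlg h} (hu : 0 < (nf u).natDegree) {p : k[X]}
    (hp : 0 < p.natDegree) : 0 < (nf (aeval u p)).natDegree := by
  have hu0 : u ≠ 0 := by
    rintro rfl
    simp at hu
  induction hn : p.natDegree generalizing p with
  | zero => omega
  | succ n ih =>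
    have hd : p.divX.natDegree = n := by
      rw [natDegree_divX_eq_natDegree_tsub_one, hn, Nat.add_sub_cancel]
    have hv : aeval u p.divX ≠ 0 := by
      rcases Nat.eq_zero_or_pos n with h0 | h0
      · rw [h0] at hd
        have h1 : p.divX.coeff 0 ≠ 0 := by
          rw [coeff_divX, ← h0, ← hn]
          exact leadingCoeff_ne_zero.mpr (by rintro rfl; simp at hp)
        rw [eq_C_of_natDegree_eq_zero hd, aeval_C, ← aeval_C (x h)]
        intro h2
        exact h1 (C_eq_zero.mp (aeval_x_injective (h2.trans (map_zero _).symm)))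
      · intro h2
        have := ih (hd.symm ▸ h0) hd
        rw [h2] at this
        simp at this
    rw [← divX_mul_X_add p, map_add, map_mul, aeval_X, aeval_C, ← aeval_C (x h), map_add, nf_aeval,
      natDegree_add_C, natDegree_nf_mul hv hu0]
    omega

/-! ### Commutators, and the ideal generated by `h(x)` -/

/-- The right ideal `h(x) A_h`, that is, the set of elements left divisible by `h(x)`, is two-sided. -/
theorem dvd_mul_of_dvd {u v : OreAlg h} (hv : aeval (x h) h ∣ v) : aeval (x h) h ∣ u * v := by
  induction u using generator_induction generalizing v with
  | hc c => rw [Algebra.commutes]; exact hv.mul_right _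
  | hx =>
    obtain ⟨v, rfl⟩ := hv
    refine ⟨x h * v, ?_⟩
    have := commute_aeval_x (h := h) X h
    rw [aeval_X] at this
    rw [← mul_assoc, this, mul_assoc]
  | ht =>
    obtain ⟨v, rfl⟩ := hv
    refine ⟨(t h + aeval (x h) (derivative h)) * v, ?_⟩
    rw [← mul_assoc, t_mul_aeval, map_mul, ← mul_add, mul_assoc]
  | hadd u v hu hv' => rw [add_mul]; exact dvd_add (hu hv) (hv' hv)
  | hmul u v hu hv' => rw [mul_assoc]; exact hu (hv' hv)

/-- The quotient of `A_h` by `h(x) A_h` is commutative. -/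
theorem dvd_commutator (u v : OreAlg h) : aeval (x h) h ∣ u * v - v * u := by
  have key : ∀ {v : OreAlg h}, aeval (x h) h ∣ x h * v - v * x h →
      aeval (x h) h ∣ t h * v - v * t h → ∀ u : OreAlg h, aeval (x h) h ∣ u * v - v * u := by
    intro v hx ht u
    induction u using generator_induction with
    | hc c => rw [Algebra.commutes, sub_self]; exact dvd_zero _
    | hx => exact hx
    | ht => exact ht
    | hadd a b ha hb =>
      rw [add_mul, mul_add, add_sub_add_comm]
      exact dvd_add ha hb
    | hmul a b ha hb =>
      have : a * b * v - v * (a * b) = a * (b * v - v * b) + (a * v - v * a) * b := by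
        noncomm_ring
      rw [this]
      exact dvd_add (dvd_mul_of_dvd hb) (ha.mul_right _)
  have hxt : aeval (x h) h ∣ t h * x h - x h * t h := by
    rw [t_mul_x, add_sub_cancel_left]
  have hz : ∀ w : OreAlg h, aeval (x h) h ∣ w * w - w * w := fun w => by
    rw [sub_self]; exact dvd_zero _
  refine key ?_ ?_ u <;> rw [← dvd_neg, neg_sub]
  · exact key (hz _) hxt v
  · refine key ?_ (hz _) v
    rwa [← dvd_neg, neg_sub]

theorem commutator_t_pow_bound (i : ℕ) :
    (nf (t h ^ (i + 1) * x h - x h * t h ^ (i + 1))).natDegree ≤ i ∧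
      (nf (t h ^ (i + 1) * x h - x h * t h ^ (i + 1))).coeff i = (i + 1 : k[X]) * h := by
  induction i with
  | zero =>
    have e : t h ^ (0 + 1) * x h - x h * t h ^ (0 + 1) = aeval (x h) h := by
      rw [zero_add, pow_one, t_mul_x, add_sub_cancel_left]
    rw [e, nf_aeval]
    simp
  | succ i ih =>
    have e : t h ^ (i + 1 + 1) * x h - x h * t h ^ (i + 1 + 1) =
        t h * (t h ^ (i + 1) * x h - x h * t h ^ (i + 1)) + aeval (x h) h * t h ^ (i + 1) := by
      rw [pow_succ' _ (i + 1), mul_sub, ← mul_assoc (t h) (x h), t_mul_x]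
      noncomm_ring
    have ht := rep_t_pow_bound (h := h) 1 ih.1
    rw [pow_one, add_comm 1 i, ih.2] at ht
    rw [e, map_add, nf_mul, nf_aeval_mul, nf_t_pow]
    refine ⟨natDegree_add_le_of_degree_le ht.1 (natDegree_C_mul_X_pow_le _ _), ?_⟩
    rw [coeff_add, ht.2]
    simp
    ring

/-- On leading terms, the commutator with `x` is `h ∂/∂t`. -/
theorem commutator_x_bound {u : OreAlg h} {m : ℕ} (hu : (nf u).natDegree ≤ m + 1) :
    (nf (u * x h - x h * u)).natDegree ≤ m ∧
      (nf (u * x h - x h * u)).coeff m = (m + 1 : k[X]) * h * (nf u).coeff (m + 1) := by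
  have e : u * x h - x h * u = ∑ i ∈ Finset.range (m + 1),
      aeval (x h) ((nf u).coeff (i + 1)) *
        (t h ^ (i + 1) * x h - x h * t h ^ (i + 1)) := by
    have hc : ∀ p : k[X], x h * aeval (x h) p = aeval (x h) p * x h := fun p => by
      simpa using commute_aeval_x (h := h) X p
    conv_lhs => rw [eq_sum_range hu, Finset.sum_mul, Finset.mul_sum, ← Finset.sum_sub_distrib,
      Finset.sum_range_succ']
    simp only [pow_zero, mul_one, hc, sub_self, add_zero, ← mul_assoc, mul_sub]
  rw [e, map_sum]
  simp only [nf_aeval_mul]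
  have hb := commutator_t_pow_bound (h := h)
  constructor
  · refine natDegree_sum_le_of_forall_le _ _ fun i hi => ?_
    rw [Finset.mem_range] at hi
    exact (natDegree_C_mul_le _ _).trans ((hb i).1.trans (by omega))
  · rw [finsetSum_coeff, Finset.sum_range_succ, Finset.sum_eq_zero, zero_add, coeff_C_mul, (hb m).2]
    · ring
    intro i hi
    rw [Finset.mem_range] at hi
    rw [coeff_C_mul, coeff_eq_zero_of_natDegree_lt ((hb i).1.trans_lt (by omega)), mul_zero]

/-- In characteristic zero `k[x]` is its own centralizer. -/
theorem exists_eq_aeval_of_commute_x [CharZero k] (h0 : h ≠ 0) {u : OreAlg h}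
    (hu : u * x h = x h * u) : ∃ p : k[X], u = aeval (x h) p := by
  refine ⟨_, eq_aeval_of_natDegree_nf ?_⟩
  by_contra hd
  obtain ⟨m, hm⟩ := Nat.exists_eq_succ_of_ne_zero hd
  have := (commutator_x_bound hm.le).2
  rw [hu, sub_self, map_zero, coeff_zero] at this
  have hm1 : (m + 1 : k[X]) ≠ 0 := by exact_mod_cast Nat.succ_ne_zero m
  have hl : (nf u).coeff (m + 1) ≠ 0 := by
    rw [← Nat.succ_eq_add_one, ← hm]
    exact leadingCoeff_ne_zero.mpr (by intro h1; simp [h1] at hm)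
  exact mul_ne_zero (mul_ne_zero hm1 h0) hl this.symm

/-- Every element of `h(x) A_h` is a commutator with `x`: the leading term in `t` is integrated, and
the rest is handled by induction on the degree. -/
theorem exists_commutator_x_eq [CharZero k] (h0 : h ≠ 0) {v : OreAlg h}
    (hv : aeval (x h) h ∣ v) : ∃ w : OreAlg h, w * x h - x h * w = v := by
  obtain ⟨v, rfl⟩ := hv
  have main : ∀ (n : ℕ) (v : OreAlg h), (nf v).degree < n →
      ∃ w : OreAlg h, w * x h - x h * w = aeval (x h) h * v := by
    intro n
    induction n with
    | zero =>
      intro v hv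
      have : v = 0 := nf_eq_zero.mp (degree_eq_bot.mp (Nat.WithBot.lt_zero_iff.mp hv))
      exact ⟨0, by simp [this]⟩
    | succ n ih =>
      intro v hv
      have hv' : (nf v).natDegree ≤ n := by
        rw [natDegree_le_iff_coeff_eq_zero]
        intro j hj
        exact coeff_eq_zero_of_degree_lt (hv.trans_le (by exact_mod_cast hj))
      -- `[f t ^ (n + 1), x]` has leading term `(n + 1) f h t ^ n`.
      set w₀ : OreAlg h := ofNF (monomial (n + 1) (C ((n + 1 : k)⁻¹) * (nf v).coeff n)) with hw₀
      have hw : nf w₀ = monomial (n + 1) (C ((n + 1 : k)⁻¹) * (nf v).coeff n) := nf_ofNF _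
      obtain ⟨v₀, hv₀⟩ := dvd_commutator w₀ (x h)
      obtain ⟨hb, hc⟩ := commutator_x_bound (u := w₀) (m := n)
        (by rw [hw]; exact natDegree_monomial_le _)
      rw [hv₀, nf_aeval_mul] at hb hc
      rw [natDegree_C_mul h0] at hb
      have hcn : (nf v₀).coeff n = (nf v).coeff n := by
        rw [coeff_C_mul, hw, coeff_monomial_same] at hc
        have hn : (n + 1 : k[X]) * C ((n + 1 : k)⁻¹) = 1 := by
          have : (n + 1 : k[X]) = C (n + 1 : k) := by simp
          rw [this, ← C_mul, mul_inv_cancel₀ (by exact_mod_cast Nat.succ_ne_zero n), C_1]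
        apply mul_left_cancel₀ h0
        rw [hc]
        linear_combination (h * (nf v).coeff n) * hn
      obtain ⟨w₁, hw₁⟩ := ih (v - v₀) (by
        rw [map_sub, degree_lt_iff_coeff_zero]
        intro j hj
        rw [coeff_sub]
        rcases hj.eq_or_lt with rfl | hj
        · rw [hcn, sub_self]
        · rw [coeff_eq_zero_of_natDegree_lt (hv'.trans_lt hj),
            coeff_eq_zero_of_natDegree_lt (hb.trans_lt hj), sub_self])
      refine ⟨w₀ + w₁, ?_⟩
      rw [add_mul, mul_add, add_sub_add_comm, hv₀, hw₁, ← mul_add]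
      congr 1
      abel
  exact main ((nf v).natDegree + 1) v
    (degree_le_natDegree.trans_lt (by exact_mod_cast Nat.lt_succ_self _))

/-! ### Automorphisms of `A_h` -/

/-- An automorphism maps `h(x) = [t, x]` to a commutator, hence into `h(x) A_h`. -/
theorem apply_h_dvd (ρ : OreAlg h ≃ₐ[k] OreAlg h) : aeval (x h) h ∣ aeval (ρ (x h)) h := by
  have e : ρ (aeval (x h) h) = ρ (t h) * ρ (x h) - ρ (x h) * ρ (t h) := by
    rw [← map_mul, ← map_mul, t_mul_x, map_add, add_sub_cancel_left]
  have e' : aeval (ρ (x h)) h = ρ (aeval (x h) h) := aeval_algHom_apply ρ.toAlgHom (x h) h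
  rw [e', e]
  exact dvd_commutator _ _

theorem dvd_apply_h (ρ : OreAlg h ≃ₐ[k] OreAlg h) : aeval (ρ (x h)) h ∣ aeval (x h) h := by
  obtain ⟨v, hv⟩ := apply_h_dvd ρ.symm
  refine ⟨ρ v, ?_⟩
  have e : ∀ u, ρ (aeval u h) = aeval (ρ u) h := fun u =>
    (aeval_algHom_apply ρ.toAlgHom u h).symm
  rw [← e, ← map_mul, ← hv, e, AlgEquiv.apply_symm_apply]

/-- Automorphisms preserve `k[x]`: otherwise `ρ(x)` has positive degree in `t`, hence so has
`ρ(h(x))`, which cannot divide `h(x)`. -/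
theorem exists_apply_x (hN : 1 ≤ h.natDegree) (ρ : OreAlg h ≃ₐ[k] OreAlg h) :
    ∃ g : k[X], ρ (x h) = aeval (x h) g := by
  have h0 : h ≠ 0 := by rintro rfl; simp at hN
  refine ⟨_, eq_aeval_of_natDegree_nf ?_⟩
  by_contra hd
  have hpos := natDegree_nf_aeval_pos (Nat.pos_of_ne_zero hd) hN
  obtain ⟨v, hv⟩ := dvd_apply_h ρ
  have hne : aeval (x h) h ≠ 0 := fun h1 => h0 (aeval_x_injective (h1.trans (map_zero _).symm))
  rw [hv] at hne
  have := congrArg (fun u => (nf u).natDegree) hv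
  simp only [nf_aeval, natDegree_C] at this
  rw [natDegree_nf_mul (left_ne_zero_of_mul hne) (right_ne_zero_of_mul hne)] at this
  omega

/-- If `h ∘ g` and `h` are associated, then `g` is affine; comparison of the coefficients of
`x ^ (N - 1)` shows that it has no constant term. -/
theorem exists_eq_C_mul_X [CharZero k] (hN : 1 ≤ h.natDegree) (hmonic : h.Monic)
    (hcoeff : h.coeff (h.natDegree - 1) = 0) {g : k[X]} (h1 : h ∣ h.comp g) (h2 : h.comp g ∣ h) :
    ∃ a : kˣ, g = C (a : k) * X ∧ h.comp g = C ((a : k) ^ h.natDegree) * h := by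
  have hassoc := associated_of_dvd_dvd h1 h2
  have hdeg : g.natDegree = 1 := by
    have := natDegree_eq_of_degree_eq (degree_eq_degree_of_associated hassoc)
    rw [natDegree_comp] at this
    exact Nat.eq_of_mul_eq_mul_left hN (by omega)
  obtain ⟨c, hc⟩ : ∃ c : k, h.comp g = C c * h := by
    obtain ⟨u, hu⟩ := hassoc
    obtain ⟨c, -, hc⟩ := isUnit_iff.mp u.isUnit
    exact ⟨c, by rw [hc, mul_comm, hu]⟩
  obtain ⟨a, ha0, b, rfl⟩ : ∃ a : k, a ≠ 0 ∧ ∃ b : k, g = C a * X + C b := by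
    refine ⟨g.coeff 1, ?_, g.coeff 0, eq_X_add_C_of_natDegree_le_one hdeg.le⟩
    rw [← hdeg]
    exact leadingCoeff_ne_zero.mpr (by rintro rfl; simp at hdeg)
  have hcomp : h.comp (C a * X + C b) = (taylor b h).comp (C a * X) := by
    rw [taylor_apply, comp_assoc]
    simp
  -- The coefficient of `x ^ (N - 1)` in `h(x + b)` is `N b`.
  have hb : b = 0 := by
    have e := congrArg (fun p => p.coeff (h.natDegree - 1)) hc
    simp only [hcomp, comp_C_mul_X_coeff, coeff_C_mul, hcoeff, mul_zero, taylor_coeff] at e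
    have e2 := (mul_eq_zero.mp e).resolve_right (pow_ne_zero _ ha0)
    have hd : (hasseDeriv (h.natDegree - 1) h).natDegree ≤ 1 :=
      (natDegree_hasseDeriv_le _ _).trans (by omega)
    rw [eq_X_add_C_of_natDegree_le_one hd, hasseDeriv_coeff, hasseDeriv_coeff, zero_add, hcoeff,
      add_comm 1, Nat.sub_add_cancel hN, hmonic.coeff_natDegree] at e2
    have hch : h.natDegree.choose (h.natDegree - 1) = h.natDegree := by
      conv_lhs => rw [Nat.choose_symm hN, Nat.choose_one_right]
    rw [hch] at e2
    simp at e2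
    rcases e2 with e2 | e2
    · omega
    · exact e2
  subst hb
  rw [C_0, add_zero] at hc ⊢
  refine ⟨Units.mk0 a ha0, rfl, ?_⟩
  have e := congrArg (fun p => p.coeff h.natDegree) hc
  simp only [comp_C_mul_X_coeff, coeff_C_mul, hmonic.coeff_natDegree, one_mul, mul_one] at e
  rw [Units.val_mk0, hc, e]

theorem zpow_natDegree_sub_one (hN : 1 ≤ h.natDegree) (a : kˣ) :
    ((a ^ ((h.natDegree : ℤ) - 1) : kˣ) : k) = (a : k) ^ (h.natDegree - 1) := by
  have : (h.natDegree : ℤ) - 1 = ((h.natDegree - 1 : ℕ) : ℤ) := by omega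
  rw [this, zpow_natCast, Units.val_pow_eq_pow_val]

theorem sigma_mul_tau_x (r : k[X]) (a : kˣ)
    (ha : h.comp (C (a : k) * X) = C ((a : k) ^ h.natDegree) * h) :
    (sigma r * tau a ha : OreAlg h ≃ₐ[k] OreAlg h) (x h) = (a : k) • x h := by
  rw [AlgEquiv.mul_apply, tau_x, map_smul, sigma_x]

theorem sigma_mul_tau_t (hN : 1 ≤ h.natDegree) (r : k[X]) (a : kˣ)
    (ha : h.comp (C (a : k) * X) = C ((a : k) ^ h.natDegree) * h) :
    (sigma r * tau a ha : OreAlg h ≃ₐ[k] OreAlg h) (t h) =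
      (a : k) ^ (h.natDegree - 1) • (t h + aeval (x h) r) := by
  rw [AlgEquiv.mul_apply, tau_t, zpow_natDegree_sub_one hN, map_smul, sigma_t]

theorem algEquiv_ext {ρ φ : OreAlg h ≃ₐ[k] OreAlg h} (hx : ρ (x h) = φ (x h))
    (ht : ρ (t h) = φ (t h)) : ρ = φ := by
  have : ρ.toAlgHom = φ.toAlgHom := hom_ext hx ht
  exact AlgEquiv.ext fun u => DFunLike.congr_fun this u

theorem exists_eq_sigma_mul_tau [CharZero k] (hN : 1 ≤ h.natDegree) (hmonic : h.Monic)
    (hcoeff : h.coeff (h.natDegree - 1) = 0) (ρ : OreAlg h ≃ₐ[k] OreAlg h) :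
    ∃ (r : k[X]) (a : kˣ) (ha : h.comp (C (a : k) * X) = C ((a : k) ^ h.natDegree) * h),
      ρ = sigma r * tau a ha := by
  obtain ⟨g, hg⟩ := exists_apply_x hN ρ
  have h1 := apply_h_dvd ρ
  have h2 := dvd_apply_h ρ
  rw [hg, ← aeval_comp] at h1 h2
  obtain ⟨a, rfl, ha⟩ := exists_eq_C_mul_X hN hmonic hcoeff (dvd_of_aeval_dvd_aeval h1)
    (dvd_of_aeval_dvd_aeval h2)
  have hx : ρ (x h) = (a : k) • x h := by
    rw [hg, map_mul, aeval_C, aeval_X, Algebra.smul_def]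
  have hpow : (a : k) ^ h.natDegree = a * (a : k) ^ (h.natDegree - 1) := by
    rw [← pow_succ', Nat.sub_add_cancel hN]
  have hh : ρ (aeval (x h) h) = (a : k) ^ h.natDegree • aeval (x h) h := by
    have e : ρ (aeval (x h) h) = aeval (ρ (x h)) h := (aeval_algHom_apply ρ.toAlgHom (x h) h).symm
    rw [e, hg, ← aeval_comp, ha, map_mul, aeval_C, Algebra.smul_def]
  have hcomm : ρ (t h) * x h - x h * ρ (t h) = (a : k) ^ (h.natDegree - 1) • aeval (x h) h := by
    have e := congrArg ρ (t_mul_x h)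
    rw [map_mul, map_add, map_mul, hx, hh, mul_smul_comm, smul_mul_assoc, hpow, mul_smul,
      ← smul_add] at e
    rw [sub_eq_iff_eq_add']
    exact smul_right_injective _ a.ne_zero e
  -- `[ρ(t), x] = a ^ (N - 1) h = [a ^ (N - 1) t, x]`, so the difference centralizes `x`.
  have hcx : (((a : k) ^ (h.natDegree - 1))⁻¹ • ρ (t h) - t h) * x h =
      x h * (((a : k) ^ (h.natDegree - 1))⁻¹ • ρ (t h) - t h) := by
    rw [sub_mul, mul_sub, t_mul_x, smul_mul_assoc, mul_smul_comm, ← sub_eq_zero]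
    have := congrArg (fun u => ((a : k) ^ (h.natDegree - 1))⁻¹ • u) hcomm
    simp only [smul_smul, inv_mul_cancel₀ (pow_ne_zero (h.natDegree - 1) a.ne_zero), one_smul,
      smul_sub] at this
    rw [← this]
    abel
  obtain ⟨r, hr⟩ := exists_eq_aeval_of_commute_x hmonic.ne_zero hcx
  refine ⟨r, a, ha, algEquiv_ext (hx.trans (sigma_mul_tau_x r a ha).symm) ?_⟩
  · rw [sigma_mul_tau_t hN, ← hr, add_sub_cancel, smul_smul,
      mul_inv_cancel₀ (pow_ne_zero _ a.ne_zero), one_smul]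

/-! ### Derivations of `A_h` and their isotropy groups -/

/-- Both `ρ D` and `E ρ` are `ρ`-derivations, so they agree once they agree on `x` and `t`. -/
theorem intertwine_of_generators {ρ : OreAlg h ≃ₐ[k] OreAlg h} {D E : Der k (OreAlg h)}
    (hx : ρ (D.1 (x h)) = E.1 (ρ (x h))) (ht : ρ (D.1 (t h)) = E.1 (ρ (t h))) (u : OreAlg h) :
    ρ (D.1 u) = E.1 (ρ u) := by
  induction u using generator_induction with
  | hc c => rw [Der.map_algebraMap, map_zero, AlgEquiv.commutes, Der.map_algebraMap]
  | hx => exact hx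
  | ht => exact ht
  | hadd u v hu hv => simp only [map_add, hu, hv]
  | hmul u v hu hv => rw [D.2, map_add, map_mul, map_mul, map_mul, hu, hv, E.2]

theorem der_ext {D E : Der k (OreAlg h)} (hx : D.1 (x h) = E.1 (x h))
    (ht : D.1 (t h) = E.1 (t h)) : D = E :=
  Subtype.ext <| LinearMap.ext fun u =>
    intertwine_of_generators (ρ := AlgEquiv.refl) hx ht u

theorem der_aeval_eq_zero {D : Der k (OreAlg h)} (hx : D.1 (x h) = 0) (p : k[X]) :
    D.1 (aeval (x h) p) = 0 := by
  induction p using Polynomial.induction_on with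
  | C c => rw [aeval_C, Der.map_algebraMap]
  | add p q hp hq => rw [map_add, map_add, hp, hq, add_zero]
  | monomial n c ih => rw [pow_succ, ← mul_assoc, map_mul, aeval_X, D.2, ih, hx, zero_mul,
      mul_zero, add_zero]

theorem Delta_aeval (s p : k[X]) : (Delta s).1 (aeval (x h) p) = 0 :=
  der_aeval_eq_zero (Delta_x s) p

theorem aeval_mul_t_sub (p : k[X]) :
    aeval (x h) p * t h - t h * aeval (x h) p = - aeval (x h) (h * derivative p) := by
  rw [t_mul_aeval]
  abel

/-- For `ρ = σ_r τ_a`, commuting with `D = ad_w + Δ_s` is tested on `x` and `t`. At `x` it says that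
`ρ(w) - w = p(x)`; at `t` it then says `a ^ (N - 1) h p' = s(a x) - a ^ (N - 1) s`, whose right side
has degree below `deg h`, so that both sides vanish. -/
theorem sigma_mul_tau_mem_isotropyGroup_iff [CharZero k] (hN : 1 ≤ h.natDegree) (w : OreAlg h)
    {s : k[X]} (hs : s.degree < h.degree) (r : k[X]) (a : kˣ)
    (ha : h.comp (C (a : k) * X) = C ((a : k) ^ h.natDegree) * h) :
    sigma r * tau a ha ∈ isotropyGroup (adDer k w + Delta s) ↔
      (∃ c : k, (sigma r * tau a ha : OreAlg h ≃ₐ[k] OreAlg h) w - w = algebraMap k (OreAlg h) c) ∧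
        s.comp (C (a : k) * X) = C ((a : k) ^ (h.natDegree - 1)) * s := by
  have h0 : h ≠ 0 := by rintro rfl; simp at hN
  set ρ : OreAlg h ≃ₐ[k] OreAlg h := sigma r * tau a ha with hρ
  set b : k := (a : k) ^ (h.natDegree - 1) with hb
  have hb0 : b ≠ 0 := pow_ne_zero _ a.ne_zero
  have hx : ρ (x h) = (a : k) • x h := sigma_mul_tau_x r a ha
  have ht : ρ (t h) = b • (t h + aeval (x h) r) := sigma_mul_tau_t hN r a ha
  have hp : ∀ p : k[X], ρ (aeval (x h) p) = aeval (x h) (p.comp (C (a : k) * X)) := fun p => by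
    have e : ρ (aeval (x h) p) = aeval (ρ (x h)) p :=
      (aeval_algHom_apply ρ.toAlgHom (x h) p).symm
    rw [e, hx, aeval_comp, map_mul, aeval_C, aeval_X, Algebra.smul_def]
  set D := adDer k w + Delta s with hD
  have hX : ρ (D.1 (x h)) - D.1 (ρ (x h)) = (a : k) • ((ρ w - w) * x h - x h * (ρ w - w)) := by
    rw [hx, map_smul, hD, Der.add_apply, adDer_apply, Delta_x, add_zero, map_sub, map_mul, map_mul, hx,
      mul_smul_comm, smul_mul_assoc, ← smul_sub, ← smul_sub]
    congr 1
    noncomm_ring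
  have hT : ρ (D.1 (t h)) - D.1 (ρ (t h)) = (ρ w - w) * ρ (t h) - ρ (t h) * (ρ w - w) +
      aeval (x h) (s.comp (C (a : k) * X) - C b * s) := by
    have e : (Delta s).1 (ρ (t h)) = aeval (x h) (C b * s) := by
      rw [ht, map_smul, map_add, Delta_t, Delta_aeval, add_zero, map_mul, aeval_C,
        Algebra.smul_def]
    rw [hD, Der.add_apply, Der.add_apply, adDer_apply, adDer_apply, Delta_t, e, map_add, hp, map_sub,
      map_mul, map_mul, map_sub]
    noncomm_ring
  constructor
  · intro hmem
    have e1 : (a : k) • ((ρ w - w) * x h - x h * (ρ w - w)) = 0 := by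
      rw [← hX, sub_eq_zero]; exact hmem _
    have e2 : (ρ w - w) * ρ (t h) - ρ (t h) * (ρ w - w) +
        aeval (x h) (s.comp (C (a : k) * X) - C b * s) = 0 := by
      rw [← hT, sub_eq_zero]; exact hmem _
    obtain ⟨p, hpw⟩ := exists_eq_aeval_of_commute_x h0
      (sub_eq_zero.mp ((smul_eq_zero.mp e1).resolve_left a.ne_zero))
    rw [hpw, ht, mul_smul_comm, smul_mul_assoc, ← smul_sub, mul_add, add_mul,
      commute_aeval_x p r, add_sub_add_right_eq_sub, aeval_mul_t_sub, Algebra.smul_def,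
      ← aeval_C (x h), ← map_neg, ← map_mul, ← map_add] at e2
    have e3 := aeval_x_injective (e2.trans (map_zero _).symm)
    have hdeg : (s.comp (C (a : k) * X) - C b * s).degree < h.degree := by
      have hs1 : ∀ n, h.natDegree ≤ n → s.coeff n = 0 := fun n hn =>
        coeff_eq_zero_of_degree_lt (hs.trans_le (by
          rw [degree_eq_natDegree h0]; exact_mod_cast hn))
      rw [degree_eq_natDegree h0, degree_lt_iff_coeff_zero]
      intro n hn
      simp [comp_C_mul_X_coeff, hs1 n hn]
    have hdvd : h ∣ s.comp (C (a : k) * X) - C b * s :=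
      ⟨C b * derivative p, by linear_combination e3⟩
    have hz := eq_zero_of_dvd_of_degree_lt hdvd hdeg
    refine ⟨?_, sub_eq_zero.mp hz⟩
    rw [hz, add_zero, mul_eq_zero, neg_eq_zero, mul_eq_zero, C_eq_zero] at e3
    have hp' := (e3.resolve_left hb0).resolve_left h0
    refine ⟨p.coeff 0, ?_⟩
    rw [hpw, ← aeval_C (x h), ← eq_C_of_derivative_eq_zero hp']
  · rintro ⟨⟨c, hc⟩, hsa⟩
    refine intertwine_of_generators ?_ ?_ <;> rw [← sub_eq_zero]
    · rw [hX, hc, Algebra.commutes, sub_self, smul_zero]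
    · rw [hT, hc, Algebra.commutes, sub_self, hsa, sub_self, map_zero, add_zero]

theorem coe_isotropyGroup_adDer_add_Delta [CharZero k] (hN : 1 ≤ h.natDegree) (hmonic : h.Monic)
    (hcoeff : h.coeff (h.natDegree - 1) = 0) (w : OreAlg h) {s : k[X]}
    (hs : s.degree < h.degree) :
    (isotropyGroup (adDer k w + Delta s) : Set (OreAlg h ≃ₐ[k] OreAlg h)) =
      {ρ | ∃ (r : k[X]) (a : kˣ)
          (ha : h.comp (C (a : k) * X) = C ((a : k) ^ h.natDegree) * h),
        ρ = sigma r * tau a ha ∧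
        (∃ c : k, ρ w - w = algebraMap k (OreAlg h) c) ∧
        s.comp (C (a : k) * X) = C ((a : k) ^ (h.natDegree - 1)) * s} := by
  ext ρ
  constructor
  · intro hρ
    obtain ⟨r, a, ha, rfl⟩ := exists_eq_sigma_mul_tau hN hmonic hcoeff ρ
    exact ⟨r, a, ha, rfl, (sigma_mul_tau_mem_isotropyGroup_iff hN w hs r a ha).mp hρ⟩
  · rintro ⟨r, a, ha, rfl, hw⟩
    exact (sigma_mul_tau_mem_isotropyGroup_iff hN w hs r a ha).mpr hw

/-- Modulo `h(x) A_h`, where all commutators vanish, the chain rule `D(p(x)) = p'(x) D(x)` holds. -/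
theorem dvd_der_aeval_sub (D : Der k (OreAlg h)) (p : k[X]) :
    aeval (x h) h ∣ D.1 (aeval (x h) p) - aeval (x h) (derivative p) * D.1 (x h) := by
  induction p using Polynomial.induction_on with
  | C c =>
    rw [aeval_C, Der.map_algebraMap, derivative_C, map_zero, zero_mul, sub_zero]
    exact dvd_zero _
  | add p q hp hq =>
    simp only [map_add, add_mul, add_sub_add_comm]
    exact dvd_add hp hq
  | monomial n c ih =>
    generalize hq : C c * X ^ n = q at ih
    have e : C c * X ^ (n + 1) = q * X := by rw [← hq, pow_succ, mul_assoc]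
    have e2 : D.1 (aeval (x h) (q * X)) - aeval (x h) (derivative (q * X)) * D.1 (x h) =
        (D.1 (aeval (x h) q) - aeval (x h) (derivative q) * D.1 (x h)) * x h -
          aeval (x h) (derivative q) * (x h * D.1 (x h) - D.1 (x h) * x h) := by
      rw [map_mul, aeval_X, D.2, derivative_mul, derivative_X, mul_one, map_add, map_mul, aeval_X]
      noncomm_ring
    rw [e, e2]
    exact dvd_sub (ih.mul_right _) (dvd_mul_of_dvd (dvd_commutator _ _))

/-- Modulo `h(x) A_h`, the chain rule gives `0 = D([t, x]) = D(h(x)) = h'(x) D(x)`, and `h'` is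
invertible there. -/
theorem dvd_der_x (hcop : IsCoprime h (derivative h)) (D : Der k (OreAlg h)) :
    aeval (x h) h ∣ D.1 (x h) := by
  have h1 : aeval (x h) h ∣ D.1 (aeval (x h) h) := by
    have e : aeval (x h) h = t h * x h - x h * t h := by rw [t_mul_x, add_sub_cancel_left]
    have e2 : D.1 (aeval (x h) h) = (D.1 (t h) * x h - x h * D.1 (t h)) +
        (t h * D.1 (x h) - D.1 (x h) * t h) := by
      conv_lhs => rw [e, map_sub, D.2, D.2]
      abel
    rw [e2]
    exact dvd_add (dvd_commutator _ _) (dvd_commutator _ _)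
  have h2 : aeval (x h) h ∣ aeval (x h) (derivative h) * D.1 (x h) := by
    have := dvd_sub h1 (dvd_der_aeval_sub D h)
    rwa [sub_sub_cancel] at this
  obtain ⟨a, b, hab⟩ := hcop
  have e : D.1 (x h) = aeval (x h) h * (aeval (x h) a * D.1 (x h)) +
      aeval (x h) b * (aeval (x h) (derivative h) * D.1 (x h)) := by
    rw [← mul_assoc, ← mul_assoc, ← map_mul, ← map_mul, ← add_mul, ← map_add, mul_comm h a, hab,
      map_one, one_mul]
  rw [e]
  exact dvd_add (dvd_mul_right _ _) (dvd_mul_of_dvd h2)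

theorem exists_derivative_eq [CharZero k] (p : k[X]) : ∃ q : k[X], derivative q = p := by
  induction p using Polynomial.induction_on' with
  | add p q hp hq =>
    obtain ⟨p', rfl⟩ := hp
    obtain ⟨q', rfl⟩ := hq
    exact ⟨p' + q', map_add _ _ _⟩
  | monomial n c =>
    refine ⟨monomial (n + 1) (c / (n + 1)), ?_⟩
    rw [derivative_monomial, Nat.add_sub_cancel]
    congr 1
    rw [Nat.cast_succ, div_mul_cancel₀]
    exact_mod_cast Nat.succ_ne_zero n

/-- An inner derivation corrects `D` to one killing `x`; this one maps `t` to some `q(x)`. Since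
`ad_g` for `g ∈ k[x]` maps `t` to `-h g'`, only the remainder of `q` modulo `h` is left. -/
theorem exists_eq_adDer_add_Delta [CharZero k] (hmonic : h.Monic)
    (hcop : IsCoprime h (derivative h)) (D : Der k (OreAlg h)) :
    ∃ (w : OreAlg h) (s : k[X]), s.degree < h.degree ∧ D = adDer k w + Delta s := by
  obtain ⟨w, hw⟩ := exists_commutator_x_eq hmonic.ne_zero (dvd_der_x hcop D)
  set E := D - adDer k w with hE
  have hEx : E.1 (x h) = 0 := by
    change D.1 (x h) - (w * x h - x h * w) = 0
    rw [hw, sub_self]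
  have hEt : E.1 (t h) * x h = x h * E.1 (t h) := by
    have e := congrArg E.1 (t_mul_x h)
    rwa [map_add, E.2, E.2, hEx, der_aeval_eq_zero hEx, mul_zero, zero_mul, add_zero, zero_add,
      add_zero] at e
  obtain ⟨q, hq⟩ := exists_eq_aeval_of_commute_x hmonic.ne_zero hEt
  obtain ⟨g, hg⟩ := exists_derivative_eq (q /ₘ h)
  refine ⟨w - aeval (x h) g, q %ₘ h, degree_modByMonic_lt q hmonic, der_ext ?_ ?_⟩
  · have e : D.1 (x h) = E.1 (x h) + (w * x h - x h * w) := by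
      change _ = (D.1 (x h) - (w * x h - x h * w)) + _
      abel
    have hc := commute_aeval_x (h := h) g X
    rw [aeval_X] at hc
    rw [e, hEx, Der.add_apply, adDer_apply, Delta_x, sub_mul, mul_sub, hc]
    abel
  · have e : D.1 (t h) = E.1 (t h) + (w * t h - t h * w) := by
      change _ = (D.1 (t h) - (w * t h - t h * w)) + _
      abel
    have hqq : aeval (x h) q = aeval (x h) (q %ₘ h) + aeval (x h) (h * derivative g) := by
      rw [← map_add, hg, modByMonic_add_div]
    have hgt := aeval_mul_t_sub (h := h) g
    rw [e, hq, hqq, Der.add_apply, adDer_apply, Delta_t, sub_mul, mul_sub, sub_sub_sub_comm, hgt]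
    abel

end OreAlg

theorem mainTheorem2 {k : Type*} [Field k] [IsAlgClosed k] [CharZero k]
    (h : k[X]) (hN : 1 ≤ h.natDegree) (hmonic : h.Monic)
    (hcoeff : h.coeff (h.natDegree - 1) = 0) :
    (∀ (w : OreAlg h) (s : k[X]), s.degree < h.degree →
      (isotropyGroup (adDer k w + OreAlg.Delta s) : Set (OreAlg h ≃ₐ[k] OreAlg h)) =
        {ρ | ∃ (r : k[X]) (a : kˣ)
            (ha : h.comp (C (a : k) * X) = C ((a : k) ^ h.natDegree) * h),
          ρ = OreAlg.sigma r * OreAlg.tau a ha ∧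
          (∃ c : k, ρ w - w = algebraMap k (OreAlg h) c) ∧
          s.comp (C (a : k) * X) = C ((a : k) ^ (h.natDegree - 1)) * s}) ∧
    (IsCoprime h (derivative h) →
      ∀ D : Der k (OreAlg h), ∃ (w : OreAlg h) (s : k[X]), s.degree < h.degree ∧
        D = adDer k w + OreAlg.Delta s ∧
        (isotropyGroup D : Set (OreAlg h ≃ₐ[k] OreAlg h)) =
          {ρ | ∃ (r : k[X]) (a : kˣ)
              (ha : h.comp (C (a : k) * X) = C ((a : k) ^ h.natDegree) * h),
            ρ = OreAlg.sigma r * OreAlg.tau a ha ∧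
            (∃ c : k, ρ w - w = algebraMap k (OreAlg h) c) ∧
            s.comp (C (a : k) * X) = C ((a : k) ^ (h.natDegree - 1)) * s}) := by
  exact ⟨fun w s hs => OreAlg.coe_isotropyGroup_adDer_add_Delta hN hmonic hcoeff w hs,
    fun hcop D => by
      obtain ⟨w, s, hs, rfl⟩ := OreAlg.exists_eq_adDer_add_Delta hmonic hcop D
      exact ⟨w, s, hs, rfl, OreAlg.coe_isotropyGroup_adDer_add_Delta hN hmonic hcoeff w hs⟩⟩
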